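/- Let $F$ be a field and let $V$ be a vector space over $F$ of finite dimension $n$. Let $L(V)$ be the monoid of all linear maps $V\to V$ and let $A(V)$ be the monoid of all affine maps $V\to V$, $x\mapsto Ax+v$ with $A\in L(V)$ and $v\in V$, both under composition. Let $GL(V)$ and $GA(V)$ be their groups of invertible elements, acting on $L(V)$ and on $A(V)$, respectively, by conjugation $f\cdot T=fTf^{-1}$. For an action of a group $G$ on a set $X$, call $x,y\in X$ orbit-equivalent if their stabilizers $G_x$ and $G_y$ are conjugate subgroups of $G$. For the two conjugation actions above, in which the stabilizer of $T$ is the centralizer of $T$ in $GL(V)$, respectively in $GA(V)$, the orbit-equivalence classes are called $z$-classes. Suppose that, up to $F$-isomorphism, $F$ has only finitely many field extensions of degree at most $n$. Then there are only finitely many $z$-classes of the $GL(V)$-action on $L(V)$, and only finitely many $z$-classes of the $GA(V)$-action on $A(V)$. -/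

import Mathlib

universe u v

open scoped Pointwise

/-- A field extension of `F` of finite degree at most `n`. -/
structure BoundedDegreeExtension (F : Type u) [Field F] (n : ℕ) : Type (u + 1) where
  /-- The underlying set of the extension field. -/
  carrier : Type u
  [field : Field carrier]
  [algebra : Algebra F carrier]
  [finiteDimensional : FiniteDimensional F carrier]
  degree_le : Module.finrank F carrier ≤ n

attribute [instance] BoundedDegreeExtension.field BoundedDegreeExtension.algebra
  BoundedDegreeExtension.finiteDimensional

/-- `F`-isomorphism of field extensions of `F` of degree at most `n`. -/
def BoundedDegreeExtension.isoSetoid (F : Type u) [Field F] (n : ℕ) :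
    Setoid (BoundedDegreeExtension F n) where
  r E₁ E₂ := Nonempty (E₁.carrier ≃ₐ[F] E₂.carrier)
  iseqv :=
    { refl := fun _ => ⟨AlgEquiv.refl⟩
      symm := fun ⟨e⟩ => ⟨e.symm⟩
      trans := fun ⟨e₁⟩ ⟨e₂⟩ => ⟨e₁.trans e₂⟩ }

/-- Up to `F`-isomorphism, `F` has only finitely many field extensions of degree at most `n`. -/
def HasFinitelyManyExtensionsOfDegreeLE (F : Type u) [Field F] (n : ℕ) : Prop :=
  Finite (Quotient (BoundedDegreeExtension.isoSetoid F n))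

/-- Orbit-equivalence for an action of a group `G` on a set `X`: two points are equivalent when
their stabilizers are conjugate subgroups of `G`. -/
def orbitEquivalence (G : Type u) (X : Type v) [Group G] [MulAction G X] : Setoid X where
  r x y := ∃ g : G, MulAut.conj g • MulAction.stabilizer G x = MulAction.stabilizer G y
  iseqv :=
    { refl := fun x => ⟨1, by rw [map_one, one_smul]⟩
      symm := by
        rintro x y ⟨g, hg⟩
        exact ⟨g⁻¹, by rw [← hg, map_inv, inv_smul_smul]⟩
      trans := by
        rintro x y z ⟨g, hg⟩ ⟨h, hh⟩
        exact ⟨h * g, by rw [map_mul, mul_smul, hg, hh]⟩ }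

/-- The `z`-classes of a monoid `M`: the orbit-equivalence classes of the action
`g • T = g * T * g⁻¹` of the group of invertible elements of `M` on `M`. Here the stabilizer
of `T` is its centralizer in the group of invertible elements. -/
abbrev ZClass (M : Type u) [Monoid M] : Type u :=
  Quotient (orbitEquivalence (ConjAct Mˣ) M)

/-! A linear map `T` makes the space an `F[X]`-module, a product of factors `F[X]/(p_i ^ e_i)`. Its
type records the number of factors, the exponents, the isomorphism classes of the residue fields
`F[X]/(p_i)`, and which of the `p_i` coincide. By hypothesis there are finitely many types, so it
suffices that maps of equal type are `z`-equivalent.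

If `S` has the same type, with primes `q_i`, one polynomial `f` exists such that `X ↦ f` induces
isomorphisms `F[X]/(q_i ^ e_i) → F[X]/(p_i ^ e_i)` for all `i`. Hence a conjugate of `S` equals
`f(T)`, and everything commuting with `T` commutes with that conjugate. Exchanging `T` and `S` and
comparing dimensions turns the inclusions into equalities. No separability is needed: `f` only has
to satisfy `p_i ∣ q_i(f)` and `p_i² ∤ q_i(f)` (`exists_dvd_comp_not_sq_dvd_comp`,
`exists_simultaneous_lift`).

An affine map extends to a linear map of `V × F` fixing the last-coordinate functional.
`CyclicDecomposition.exists_eval_one` normalizes the decomposition so that this functional is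
evaluation at `1` on one factor with prime `X - 1`. The intertwiner then preserves the functional
because `f(1) = 1`, so it comes from an affine map. -/

open Polynomial

/-! ### Isomorphisms of the algebras `F[X]/(p ^ e)` given by substitution. -/

section PolynomialLocalAlgebras

variable {F : Type*} [Field F]

/-- Lifting an isomorphism of residue fields to the first infinitesimal neighbourhood. -/
lemma exists_dvd_comp_not_sq_dvd_comp {p q : F[X]} (hp : Irreducible p) (hq : Irreducible q)
    (φ : AdjoinRoot q ≃ₐ[F] AdjoinRoot p) :
    ∃ y : F[X], p ∣ q.comp y ∧ ¬ p ^ 2 ∣ q.comp y := by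
  obtain ⟨f, hf⟩ := AdjoinRoot.mk_surjective (φ (AdjoinRoot.root q))
  obtain ⟨g, hg⟩ := AdjoinRoot.mk_surjective (φ.symm (AdjoinRoot.root p))
  have hφ : ∀ h : F[X], φ (AdjoinRoot.mk q h) = AdjoinRoot.mk p (h.comp f) := by
    intro h
    rw [← AdjoinRoot.aeval_eq, ← AdjoinRoot.aeval_eq, aeval_comp, AdjoinRoot.aeval_eq f, hf,
      ← aeval_algHom_apply φ]
  have hφ' : ∀ h : F[X], φ.symm (AdjoinRoot.mk p h) = AdjoinRoot.mk q (h.comp g) := by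
    intro h
    rw [← AdjoinRoot.aeval_eq, ← AdjoinRoot.aeval_eq, aeval_comp, AdjoinRoot.aeval_eq g, hg,
      ← aeval_algHom_apply φ.symm]
  have hpf : p ∣ q.comp f := by
    rw [← AdjoinRoot.mk_eq_zero, ← hφ, AdjoinRoot.mk_self, map_zero]
  have hqg : q ∣ p.comp g := by
    rw [← AdjoinRoot.mk_eq_zero, ← hφ', AdjoinRoot.mk_self, map_zero]
  have taylor : ∀ r a b : F[X], b ^ 2 ∣ r.comp (a + b) - r.comp a - r.derivative.comp a * b := by
    intro r a b
    obtain ⟨k, hk⟩ := Polynomial.binomExpansion (r.map C) a b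
    refine ⟨k, ?_⟩
    rw [eval_map, eval_map, derivative_map, eval_map] at hk
    simp only [comp] at *
    rw [hk]; ring
  -- If `f` fails, `f + p` works: were `p²` to divide both `q(f)` and `q(f + p)`, Taylor expansion
  -- would give `p ∣ q'(f)`, hence `q ∣ q'`. This inseparable case is excluded by composing with the
  -- lift `g` of the inverse.
  by_cases h2 : p ^ 2 ∣ q.comp f
  · refine ⟨f + p, ?_, ?_⟩
    · have h := taylor q f p
      have h' : p ∣ q.comp (f + p) - q.comp f - q.derivative.comp f * p :=
        (dvd_pow_self p two_ne_zero).trans h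
      have := (dvd_add (dvd_add h' hpf) (dvd_mul_left p (q.derivative.comp f)))
      convert this using 1
      ring
    · intro h3
      have h := taylor q f p
      have h4 : p ^ 2 ∣ q.derivative.comp f * p := by
        have := dvd_sub (dvd_sub h3 h2) h
        simpa using this
      rw [sq, mul_dvd_mul_iff_right hp.ne_zero] at h4
      have h5 : q ∣ q.derivative := by
        rw [← AdjoinRoot.mk_eq_zero] at h4 ⊢
        rw [← hφ] at h4
        simpa using h4
      have hgf : q ∣ f.comp g - X := by
        rw [← AdjoinRoot.mk_eq_zero, map_sub, ← hφ', hf, AlgEquiv.symm_apply_apply,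
          AdjoinRoot.mk_X, sub_self]
      obtain ⟨k, hk⟩ := hgf
      -- Since `f(g) = X + qk` and `q ∣ q'`, also `q(f(g)) ≡ q` modulo `q²`, which forces `q² ∣ q`.
      have h6 : q ^ 2 ∣ q.comp (f.comp g) := by
        obtain ⟨c, hc⟩ := h2
        rw [← comp_assoc, hc, mul_comp, pow_comp]
        exact (pow_dvd_pow_of_dvd hqg 2).mul_right _
      have h7 := taylor q X (q * k)
      rw [show X + q * k = f.comp g by rw [← hk]; ring, comp_X, comp_X] at h7
      have h8 : q ^ 2 ∣ (q * k) ^ 2 := by rw [mul_pow]; exact dvd_mul_right _ _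
      have h9 : q ^ 2 ∣ q.derivative * (q * k) := by
        rw [sq, ← mul_assoc]
        exact (mul_dvd_mul_right h5 q).mul_right k
      have h10 := dvd_sub (dvd_sub h6 (h8.trans h7)) h9
      have h11 : q ^ 2 ∣ q := by
        convert h10 using 1; ring
      rw [sq] at h11
      have := (mul_dvd_mul_iff_left hq.ne_zero).1 (h11.trans (mul_one q).symm.dvd)
      exact hq.not_isUnit (isUnit_of_dvd_one this)
  · exact ⟨f, hpf, h2⟩

/-- Substituting `f` carries the `q`-adic valuation to the `p`-adic one: `q(f)` has valuation
exactly one, and a Bézout relation shows that a factor prime to `q` stays prime to `p`. -/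
lemma pow_dvd_of_pow_dvd_comp {p q f : F[X]} (hp : Irreducible p) (hq : Irreducible q)
    (h1 : p ∣ q.comp f) (h2 : ¬ p ^ 2 ∣ q.comp f) {e : ℕ} {g : F[X]}
    (hg : p ^ e ∣ g.comp f) : q ^ e ∣ g := by
  rcases eq_or_ne g 0 with rfl | hg0
  · exact dvd_zero _
  obtain ⟨k, h, hqh, rfl⟩ := WfDvdMonoid.max_power_factor hg0 hq
  obtain ⟨u, hu⟩ := h1
  have hpp := hp.prime
  have hpu : ¬ p ∣ u := by
    rintro ⟨c, rfl⟩
    exact h2 ⟨c, by rw [hu]; ring⟩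
  have hph : ¬ p ∣ h.comp f := by
    intro hd
    obtain ⟨a, b, hab⟩ := (hq.coprime_iff_not_dvd.2 hqh)
    have := congrArg (fun r => r.comp f) hab
    simp only [add_comp, mul_comp, one_comp] at this
    apply hp.not_isUnit
    apply isUnit_of_dvd_one
    rw [← this, hu]
    exact dvd_add ((dvd_mul_right p u).mul_left _) (hd.mul_left _)
  rw [mul_comp, pow_comp, hu, mul_pow, mul_assoc] at hg
  have hnd : ¬ p ∣ u ^ k * h.comp f := by
    intro hd
    rcases hpp.dvd_or_dvd hd with hd | hd
    · exact hpu (hpp.dvd_of_dvd_pow hd)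
    · exact hph hd
  have hek : e ≤ k := by
    by_contra! hlt
    obtain ⟨c, hc⟩ := (pow_dvd_pow p hlt).trans hg
    rw [pow_succ, mul_assoc] at hc
    exact hnd ⟨c, mul_left_cancel₀ (pow_ne_zero k hp.ne_zero) hc⟩
  exact (pow_dvd_pow q hek).mul_right h

/-- The first divisibility makes the substitution well defined, the second makes it injective, and
equal degrees make it bijective. -/
lemma exists_adjoinRoot_pow_algEquiv {p q f : F[X]} (hp : Irreducible p) (hq : Irreducible q)
    (hdeg : p.natDegree = q.natDegree)
    (h1 : p ∣ q.comp f) (h2 : ¬ p ^ 2 ∣ q.comp f) (e : ℕ) :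
    ∃ θ : AdjoinRoot (q ^ e) ≃ₐ[F] AdjoinRoot (p ^ e),
      ∀ h : F[X], θ (AdjoinRoot.mk _ h) = AdjoinRoot.mk _ (h.comp f) := by
  have hz : aeval (AdjoinRoot.mk (p ^ e) f) (q ^ e) = 0 := by
    rw [← AdjoinRoot.aeval_eq, ← aeval_comp, AdjoinRoot.aeval_eq, AdjoinRoot.mk_eq_zero, pow_comp]
    exact pow_dvd_pow_of_dvd h1 e
  let θ : AdjoinRoot (q ^ e) →ₐ[F] AdjoinRoot (p ^ e) :=
    AdjoinRoot.liftAlgHom (q ^ e) (Algebra.ofId _ _) (AdjoinRoot.mk (p ^ e) f) hz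
  have hθ : ∀ h : F[X], θ (AdjoinRoot.mk _ h) = AdjoinRoot.mk _ (h.comp f) := by
    intro h
    rw [← AdjoinRoot.aeval_eq, ← AdjoinRoot.aeval_eq, aeval_comp, AdjoinRoot.aeval_eq f,
      ← aeval_algHom_apply]
    exact congrArg (fun x => aeval x h) (AdjoinRoot.lift_root hz)
  have hinj : Function.Injective θ := by
    rw [injective_iff_map_eq_zero]
    intro a ha
    obtain ⟨g, rfl⟩ := AdjoinRoot.mk_surjective a
    rw [hθ, AdjoinRoot.mk_eq_zero] at ha
    rw [AdjoinRoot.mk_eq_zero]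
    exact pow_dvd_of_pow_dvd_comp hp hq h1 h2 ha
  have hq0 := pow_ne_zero e hq.ne_zero
  have hp0 := pow_ne_zero e hp.ne_zero
  have : FiniteDimensional F (AdjoinRoot (q ^ e)) := (AdjoinRoot.powerBasis hq0).finite
  have : FiniteDimensional F (AdjoinRoot (p ^ e)) := (AdjoinRoot.powerBasis hp0).finite
  have hfr : Module.finrank F (AdjoinRoot (q ^ e)) = Module.finrank F (AdjoinRoot (p ^ e)) := by
    rw [(AdjoinRoot.powerBasis hq0).finrank, (AdjoinRoot.powerBasis hp0).finrank]
    simp [hdeg]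
  have hsurj : Function.Surjective θ :=
    (LinearMap.injective_iff_surjective_of_finrank_eq_finrank (f := θ.toLinearMap) hfr).1 hinj
  exact ⟨AlgEquiv.ofBijective θ ⟨hinj, hsurj⟩, hθ⟩

lemma natDegree_eq_of_adjoinRoot_algEquiv {p q : F[X]} (hp : p ≠ 0) (hq : q ≠ 0)
    (φ : AdjoinRoot p ≃ₐ[F] AdjoinRoot q) : p.natDegree = q.natDegree := by
  have := φ.toLinearEquiv.finrank_eq
  rwa [(AdjoinRoot.powerBasis hq).finrank, (AdjoinRoot.powerBasis hp).finrank,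
    AdjoinRoot.powerBasis_dim, AdjoinRoot.powerBasis_dim] at this

/-- One polynomial that lifts finitely many residue field isomorphisms simultaneously. -/
lemma exists_simultaneous_lift {ι : Type*} [Finite ι] {p q : ι → F[X]}
    (hp : ∀ i, Irreducible (p i)) (hpm : ∀ i, (p i).Monic) (hq : ∀ i, Irreducible (q i))
    (hpq : ∀ i j, p i = p j → q i = q j)
    (φ : ∀ i, Nonempty (AdjoinRoot (q i) ≃ₐ[F] AdjoinRoot (p i))) :
    ∃ f : F[X], ∀ i, p i ∣ (q i).comp f ∧ ¬ p i ^ 2 ∣ (q i).comp f := by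
  -- One lift per distinct prime rather than per index, so that the moduli below are pairwise
  -- coprime; the same `y` serves repeated indices by `hpq`.
  have key : ∀ P : Set.range p, ∃ y : F[X], ∀ i, p i = P →
      P.1 ∣ (q i).comp y ∧ ¬ P.1 ^ 2 ∣ (q i).comp y := by
    rintro ⟨_, i, rfl⟩
    obtain ⟨y, hy⟩ := exists_dvd_comp_not_sq_dvd_comp (hp i) (hq i) (φ i).some
    refine ⟨y, fun j hj => ?_⟩
    rw [hpq j i hj]
    exact hy
  choose y hy using key
  have hcop : Pairwise fun P Q : Set.range p =>
      IsCoprime (Ideal.span {P.1 ^ 2}) (Ideal.span {Q.1 ^ 2}) := by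
    rintro ⟨_, i, rfl⟩ ⟨_, j, rfl⟩ hne
    rw [Ideal.isCoprime_span_singleton_iff]
    apply IsCoprime.pow
    rw [(hp i).coprime_iff_not_dvd]
    intro hd
    apply hne
    exact Subtype.ext (eq_of_monic_of_associated (hpm i) (hpm j)
      ((hp i).associated_of_dvd (hp j) hd))
  -- Chinese remainder theorem modulo the squares: both required conditions depend only on `f`
  -- modulo `p i ^ 2`.
  obtain ⟨f, hf⟩ := Ideal.exists_forall_sub_mem_ideal hcop y
  refine ⟨f, fun i => ?_⟩
  have hfi := hf ⟨p i, i, rfl⟩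
  obtain ⟨h1, h2⟩ := hy ⟨p i, i, rfl⟩ i rfl
  rw [Ideal.mem_span_singleton] at hfi
  have hd : p i ^ 2 ∣ (q i).comp f - (q i).comp (y ⟨p i, i, rfl⟩) := by
    refine hfi.trans ?_
    have := sub_dvd_eval_sub f (y ⟨p i, i, rfl⟩) ((q i).map C)
    simpa [eval_map, comp] using this
  constructor
  · have := dvd_add ((dvd_pow_self (p i) two_ne_zero).trans hd) h1
    rwa [sub_add_cancel] at this
  · intro h
    have := dvd_sub h hd
    rw [sub_sub_cancel] at this
    exact h2 this

end PolynomialLocalAlgebras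

/-! ### Primary cyclic decompositions and their intertwiners. -/

section CyclicDecomposition

variable {F : Type*} [Field F] {W : Type*} [AddCommGroup W] [Module F W]

/-- A decomposition of the `F[X]`-module defined by `T` as a product of modules
`F[X] / (p i ^ e i)`. -/
structure CyclicDecomposition (T : Module.End F W) {ι : Type*} (p : ι → F[X]) (e : ι → ℕ) where
  /-- The coordinates of a vector. -/
  toEquiv : W ≃ₗ[F] ((i : ι) → AdjoinRoot (p i ^ e i))
  map_apply : ∀ w i, toEquiv (T w) i = AdjoinRoot.root _ * toEquiv w i

namespace CyclicDecomposition

variable {T S : Module.End F W} {ι : Type*} {p q : ι → F[X]} {e : ι → ℕ}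

lemma map_aeval_apply (D : CyclicDecomposition T p e) (f : F[X]) (w : W) (i : ι) :
    D.toEquiv (aeval T f w) i = AdjoinRoot.mk _ f * D.toEquiv w i := by
  induction f using Polynomial.induction_on' generalizing w with
  | add f g hf hg => simp [hf, hg, add_mul]
  | monomial n a =>
    induction n generalizing w with
    | zero =>
      rw [monomial_zero_left, aeval_C, AdjoinRoot.mk_C, Module.algebraMap_end_apply, map_smul,
        Pi.smul_apply, Algebra.smul_def]
      rfl
    | succ n ih =>
      rw [← monomial_mul_X, map_mul, Module.End.mul_apply, aeval_X, ih, D.map_apply, map_mul,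
        AdjoinRoot.mk_X, mul_assoc]

/-- A decomposition over `F[X]` gives coordinates over `F`. -/
noncomputable def ofLinearEquiv
    (Ψ : Module.AEval' T ≃ₗ[F[X]] ((i : ι) → F[X] ⧸ Ideal.span {p i ^ e i})) :
    CyclicDecomposition T p e where
  toEquiv :=
    { toFun := fun w => Ψ (Module.AEval'.of T w)
      invFun := fun x => (Module.AEval'.of T).symm (Ψ.symm x)
      map_add' := fun x y => by rw [map_add, map_add]; rfl
      map_smul' := fun c x => by
        rw [map_smul, ← Module.AEval.C_smul, map_smul]
        funext i
        exact (Algebra.smul_def c (show AdjoinRoot (p i ^ e i) from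
          Ψ (Module.AEval'.of T x) i)).symm
      left_inv := fun w => by simp
      right_inv := fun x =>
        (congrArg Ψ ((Module.AEval'.of T).apply_symm_apply (Ψ.symm x))).trans
          (Ψ.apply_symm_apply x) }
  map_apply := fun w i => by
    change Ψ (Module.AEval'.of T (T w)) i = _
    rw [← Module.AEval'.X_smul_of, map_smul]
    rfl

lemma sum_mul_natDegree [Fintype ι] (D : CyclicDecomposition T p e)
    (hp : ∀ i, Irreducible (p i)) : ∑ i, e i * (p i).natDegree = Module.finrank F W := by
  have h0 : ∀ i, p i ^ e i ≠ 0 := fun i => pow_ne_zero _ (hp i).ne_zero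
  have : ∀ i, FiniteDimensional F (AdjoinRoot (p i ^ e i)) :=
    fun i => (AdjoinRoot.powerBasis (h0 i)).finite
  rw [D.toEquiv.finrank_eq, Module.finrank_pi_fintype]
  refine Finset.sum_congr rfl fun i _ => ?_
  rw [(AdjoinRoot.powerBasis (h0 i)).finrank, AdjoinRoot.powerBasis_dim, natDegree_pow]

/-- Restriction of families to the indices outside which the components are trivial. -/
lemma exists_linearEquiv_comp {R : Type*} [Ring R] {κ : Type*} {M : ι → Type*}
    [∀ i, AddCommGroup (M i)] [∀ i, Module R (M i)] (σ : κ → ι) (hσ : Function.Injective σ)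
    (hM : ∀ i, i ∉ Set.range σ → Subsingleton (M i)) :
    Nonempty (((i : ι) → M i) ≃ₗ[R] ((k : κ) → M (σ k))) := by
  classical
  refine ⟨LinearEquiv.ofBijective (LinearMap.pi fun k => LinearMap.proj (σ k)) ⟨?_, ?_⟩⟩
  · intro x y hxy
    funext i
    by_cases hi : i ∈ Set.range σ
    · obtain ⟨k, rfl⟩ := hi
      exact congrFun hxy k
    · have := hM i hi
      exact Subsingleton.elim _ _
  · intro y
    refine ⟨fun i => if h : ∃ k, σ k = i then h.choose_spec ▸ y h.choose else 0, ?_⟩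
    funext k
    have h : ∃ k', σ k' = σ k := ⟨k, rfl⟩
    simp only [LinearMap.pi_apply, LinearMap.proj_apply, dif_pos h]
    have h2 : ∀ (k' : κ) (hk : k' = k) (hs : σ k' = σ k), (hs ▸ y k' : M (σ k)) = y k := by
      rintro k' rfl hs
      rfl
    exact h2 _ (hσ h.choose_spec) _

theorem exists_fin [FiniteDimensional F W] (T : Module.End F W) :
    ∃ (d : ℕ) (p : Fin d → F[X]) (e : Fin d → ℕ), (∀ i, Irreducible (p i)) ∧
      (∀ i, (p i).Monic) ∧ (∀ i, 0 < e i) ∧ Nonempty (CyclicDecomposition T p e) := by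
  classical
  obtain ⟨ι, _, p, hp, e, ⟨Ψ⟩⟩ := Module.equiv_directSum_of_isTorsion
    (Module.AEval.isTorsion_of_finiteDimensional (K := F) (M := W) (a := T))
  have e1 := Ψ.trans (DirectSum.linearEquivFunOnFintype F[X] ι _)
  -- Discarding the zero factors lets the dimension bound the number of factors.
  let σ := (Fintype.equivFin {i // e i ≠ 0}).symm
  obtain ⟨e2⟩ := exists_linearEquiv_comp (R := F[X])
    (M := fun i => F[X] ⧸ Ideal.span {p i ^ e i})
    (fun k => (σ k : ι)) (Subtype.val_injective.comp σ.injective) (by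
      intro i hi
      have : e i = 0 := by
        by_contra h
        exact hi ⟨σ.symm ⟨i, h⟩, by simp⟩
      rw [this, pow_zero, Ideal.span_singleton_one]
      exact Ideal.Quotient.subsingleton_iff.2 rfl)
  have hspan : ∀ k, Ideal.span {p (σ k) ^ e (σ k)} =
      Ideal.span {(normalize (p (σ k))) ^ e (σ k)} := fun k =>
    Ideal.span_singleton_eq_span_singleton.2 ((associated_normalize _).pow_pow)
  let e3 := LinearEquiv.piCongrRight (R := F[X]) fun k => Submodule.quotEquivOfEq _ _ (hspan k)
  exact ⟨_, fun k => normalize (p (σ k)), fun k => e (σ k),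
    fun k => (associated_normalize _).irreducible (hp _),
    fun k => monic_normalize (hp _).ne_zero,
    fun k => Nat.pos_of_ne_zero (σ k).2,
    ⟨ofLinearEquiv ((e1.trans e2).trans e3)⟩⟩

/-- Two decompositions of the same type are intertwined by a polynomial. -/
theorem exists_intertwining [Finite ι] (D : CyclicDecomposition T p e)
    (E : CyclicDecomposition S q e)
    (hp : ∀ i, Irreducible (p i)) (hpm : ∀ i, (p i).Monic) (hq : ∀ i, Irreducible (q i))
    (hpq : ∀ i j, p i = p j → q i = q j)
    (φ : ∀ i, Nonempty (AdjoinRoot (q i) ≃ₐ[F] AdjoinRoot (p i))) :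
    ∃ (f : F[X]) (g : W ≃ₗ[F] W), (∀ w, g (S w) = aeval T f (g w)) ∧
      (∀ i, p i ∣ (q i).comp f) ∧
      ∀ w i h, E.toEquiv w i = AdjoinRoot.mk _ h →
        D.toEquiv (g w) i = AdjoinRoot.mk _ (h.comp f) := by
  obtain ⟨f, hf⟩ := exists_simultaneous_lift hp hpm hq hpq φ
  choose θ hθ using fun i => exists_adjoinRoot_pow_algEquiv (hp i) (hq i)
    (natDegree_eq_of_adjoinRoot_algEquiv (hq i).ne_zero (hp i).ne_zero (φ i).some).symm
    (hf i).1 (hf i).2 (e i)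
  let g := (E.toEquiv.trans (LinearEquiv.piCongrRight fun i => (θ i).toLinearEquiv)).trans
    D.toEquiv.symm
  have hg : ∀ w i, D.toEquiv (g w) i = θ i (E.toEquiv w i) := by
    intro w i
    simp [g]
  refine ⟨f, g, ?_, fun i => (hf i).1, ?_⟩
  · intro w
    apply D.toEquiv.injective
    funext i
    rw [hg, E.map_apply, map_mul, D.map_aeval_apply, hg, ← AdjoinRoot.mk_X, hθ, X_comp]
  · intro w i h hw
    rw [hg, hw, hθ]

/-- Along a decomposition, a nonzero invariant functional can be made the evaluation at `1` of
one coordinate. -/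
theorem exists_eval_one [FiniteDimensional F W] [Finite ι] (D : CyclicDecomposition T p e)
    (hp : ∀ i, Irreducible (p i)) (hpm : ∀ i, (p i).Monic)
    {φ : W →ₗ[F] F} (hφ : φ ≠ 0) (hφT : ∀ w, φ (T w) = φ w) :
    ∃ (i₀ : ι) (E : CyclicDecomposition T p e), p i₀ = X - C 1 ∧
      ∀ w h, E.toEquiv w i₀ = AdjoinRoot.mk _ h → φ w = h.eval 1 := by
  classical
  have := Fintype.ofFinite ι
  let ψ := φ ∘ₗ D.toEquiv.symm.toLinearMap
  let s : (i : ι) → AdjoinRoot (p i ^ e i) → F := fun i m => ψ (Pi.single i m)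
  have hφaeval : ∀ (f : F[X]) w, φ (aeval T f w) = f.eval 1 * φ w := by
    intro f w
    induction f using Polynomial.induction_on' generalizing w with
    | add f g hf hg => simp [hf, hg, add_mul]
    | monomial n a =>
      induction n generalizing w with
      | zero => simp [monomial_zero_left, Module.algebraMap_end_apply]
      | succ n ih =>
        rw [← monomial_mul_X, map_mul, Module.End.mul_apply, aeval_X, ih, hφT]
        simp
  have hs : ∀ i h, s i (AdjoinRoot.mk _ h) = h.eval 1 * s i 1 := by
    intro i h
    have : D.toEquiv.symm (Pi.single i (AdjoinRoot.mk _ h)) =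
        aeval T h (D.toEquiv.symm (Pi.single i 1)) := by
      apply D.toEquiv.injective
      funext j
      rw [D.map_aeval_apply, LinearEquiv.apply_symm_apply, LinearEquiv.apply_symm_apply]
      by_cases hj : j = i
      · subst hj; simp
      · simp [Pi.single_eq_of_ne hj]
    change φ (D.toEquiv.symm _) = _ * φ (D.toEquiv.symm _)
    rw [this, hφaeval]
  have hψ : ∀ m, ψ m = ∑ i, s i (m i) := by
    intro m
    conv_lhs => rw [← Finset.univ_sum_single m]
    rw [map_sum]
  -- The functional kills `p i ^ e i = 0`, so `p i` vanishes at `1` wherever the functional is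
  -- nonzero.
  have hX : ∀ i, s i 1 ≠ 0 → p i = X - C 1 := by
    intro i hi
    have h1 := hs i (p i ^ e i)
    rw [AdjoinRoot.mk_self] at h1
    have h2 : s i 0 = 0 := by simp [s]
    rw [h2, eq_comm, mul_eq_zero, or_iff_left hi, eval_pow] at h1
    have h3 : (p i).IsRoot 1 := eq_zero_of_pow_eq_zero h1
    exact (eq_of_monic_of_associated (monic_X_sub_C 1) (hpm i)
      ((irreducible_X_sub_C 1).associated_of_dvd (hp i) (dvd_iff_isRoot.2 h3))).symm
  have hne : (Finset.univ.filter fun i => s i 1 ≠ 0).Nonempty := by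
    by_contra hemp
    rw [Finset.not_nonempty_iff_eq_empty, Finset.filter_eq_empty_iff] at hemp
    apply hφ
    ext w
    have : φ w = ψ (D.toEquiv w) := by simp [ψ]
    rw [this, hψ]
    refine Finset.sum_eq_zero fun i _ => ?_
    obtain ⟨h, hh⟩ := AdjoinRoot.mk_surjective (D.toEquiv w i)
    rw [← hh, hs, not_not.1 (hemp (Finset.mem_univ i)), mul_zero]
  -- The least exponent ensures that every other factor seen by the functional projects onto factor
  -- `i₀`.
  obtain ⟨i₀, hi₀, hmin⟩ := Finset.exists_min_image _ e hne
  simp only [Finset.mem_filter, Finset.mem_univ, true_and] at hi₀ hmin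
  have hL : ∀ j, ∃ L : AdjoinRoot (p j ^ e j) →ₗ[F] AdjoinRoot (p i₀ ^ e i₀),
      ∀ h, L (AdjoinRoot.mk _ h) = AdjoinRoot.mk _ (C (s j 1) * h) := by
    intro j
    by_cases hj : s j 1 = 0
    · exact ⟨0, fun h => by simp [hj]⟩
    · have hdvd : p i₀ ^ e i₀ ∣ p j ^ e j := by
        rw [hX j hj, hX i₀ hi₀]
        exact pow_dvd_pow _ (hmin j hj)
      refine ⟨s j 1 • (AdjoinRoot.algHomOfDvd F _ _ hdvd).toLinearMap, fun h => ?_⟩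
      have : AdjoinRoot.algHomOfDvd F _ _ hdvd (AdjoinRoot.mk _ h) = AdjoinRoot.mk _ h := by
        rw [← AdjoinRoot.aeval_eq, ← AdjoinRoot.aeval_eq, ← aeval_algHom_apply,
          AdjoinRoot.algHomOfDvd_root]
      rw [LinearMap.smul_apply, AlgHom.toLinearMap_apply, this, map_mul, AdjoinRoot.mk_C,
        Algebra.smul_def]
      rfl
  choose L hL using hL
  have hLroot : ∀ j m, L j (AdjoinRoot.root _ * m) = AdjoinRoot.root _ * L j m := by
    intro j m
    obtain ⟨h, rfl⟩ := AdjoinRoot.mk_surjective m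
    rw [← AdjoinRoot.mk_X, ← AdjoinRoot.mk_X, ← map_mul, hL, hL, ← map_mul]
    congr 1; ring
  -- Coordinate `i₀` becomes `∑ j, s j 1 • m j`, whose value at `1` is the functional. This commutes
  -- with `X`, and is invertible because `s i₀ 1 ≠ 0`.
  let U : ((i : ι) → AdjoinRoot (p i ^ e i)) →ₗ[F] ((i : ι) → AdjoinRoot (p i ^ e i)) :=
    { toFun := fun m => Function.update m i₀ (∑ j, L j (m j))
      map_add' := fun m m' => by
        funext k
        by_cases hk : k = i₀
        · subst hk; simp [Finset.sum_add_distrib]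
        · simp [hk]
      map_smul' := fun c m => by
        funext k
        by_cases hk : k = i₀
        · subst hk; simp [Finset.smul_sum]
        · simp [hk] }
  have hU₀ : ∀ m, U m i₀ = ∑ j, L j (m j) := fun m => Function.update_self i₀ (∑ j, L j (m j)) m
  have hU : ∀ m k, k ≠ i₀ → U m k = m k := fun m k hk => Function.update_of_ne hk ..
  have hUinj : Function.Injective U := by
    rw [injective_iff_map_eq_zero]
    intro m hm
    have h1 : ∀ k, k ≠ i₀ → m k = 0 := fun k hk => by rw [← hU m k hk, hm]; rfl
    have h2 : L i₀ (m i₀) = 0 := by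
      have h3 := hU₀ m
      rw [hm, Finset.sum_eq_single i₀ (fun j _ hj => by rw [h1 j hj, map_zero]) (by simp)] at h3
      exact h3.symm
    have h4 : m i₀ = 0 := by
      obtain ⟨h, hh⟩ := AdjoinRoot.mk_surjective (m i₀)
      rw [← hh, hL, map_mul] at h2
      rw [← hh]
      have : IsUnit (AdjoinRoot.mk (p i₀ ^ e i₀) (C (s i₀ 1))) :=
        (isUnit_C.2 (isUnit_iff_ne_zero.2 hi₀)).map _
      exact (this.mul_right_eq_zero).1 h2
    funext k
    by_cases hk : k = i₀
    · subst hk; exact h4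
    · exact h1 k hk
  have : FiniteDimensional F ((i : ι) → AdjoinRoot (p i ^ e i)) := D.toEquiv.finiteDimensional
  let U' := LinearEquiv.ofInjectiveEndo U hUinj
  have hU' : ∀ m, U' m = U m := fun m => rfl
  refine ⟨i₀, ⟨D.toEquiv.trans U', ?_⟩, hX i₀ hi₀, ?_⟩
  · intro w i
    rw [LinearEquiv.trans_apply, LinearEquiv.trans_apply, hU', hU']
    by_cases hi : i = i₀
    · subst hi
      rw [hU₀, hU₀, Finset.mul_sum]
      exact Finset.sum_congr rfl fun j _ => by rw [D.map_apply, hLroot]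
    · rw [hU _ _ hi, hU _ _ hi, D.map_apply]
  · intro w h hw
    rw [LinearEquiv.trans_apply, hU', hU₀] at hw
    have hφw : φ w = ψ (D.toEquiv w) := by simp [ψ]
    choose r hr using fun j => AdjoinRoot.mk_surjective (D.toEquiv w j)
    simp only [← hr, hL] at hw
    rw [← map_sum, AdjoinRoot.mk_eq_mk] at hw
    have hroot : (p i₀ ^ e i₀).eval 1 = 0 := by
      have h1 := hs i₀ (p i₀ ^ e i₀)
      rw [AdjoinRoot.mk_self] at h1
      have h2 : s i₀ 0 = 0 := by simp [s]
      rwa [h2, eq_comm, mul_eq_zero, or_iff_left hi₀] at h1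
    have h5 : (∑ j, C (s j 1) * r j - h).eval 1 = 0 :=
      eval_eq_zero_of_dvd_of_eval_eq_zero hw hroot
    rw [eval_sub, sub_eq_zero] at h5
    rw [hφw, hψ, ← h5, eval_finsetSum]
    refine Finset.sum_congr rfl fun j _ => ?_
    rw [← hr, hs, eval_mul, eval_C, mul_comm]

end CyclicDecomposition

end CyclicDecomposition

/-! ### From inclusions of centralizers to conjugate stabilizers. -/

section ZClasses

lemma finite_quotient_of_invariant {X K : Type*} [Finite K] (s : Setoid X) (R : X → K → Prop)
    (hR : ∀ x, ∃ k, R x k) (hs : ∀ x y k, R x k → R y k → s.r x y) : Finite (Quotient s) := by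
  choose t ht using hR
  refine Finite.of_injective (fun a : Quotient s => t a.out) fun a b hab => ?_
  have hab' : t a.out = t b.out := hab
  rw [← a.out_eq, ← b.out_eq]
  exact Quotient.sound (hs _ _ _ (ht _) (hab' ▸ ht _))

/-- If the centralizers have a well-behaved dimension, mutual inclusion of centralizers up to
conjugation implies `z`-equivalence. -/
lemma orbitEquivalence_of_commute {M : Type*} [Monoid M] (δ : M → ℕ)
    (hconj : ∀ (g : Mˣ) (T : M), δ (g * T * ↑g⁻¹) ≤ δ T)
    (hmono : ∀ T S : M, (∀ x, Commute x T → Commute x S) → δ T ≤ δ S)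
    (heq : ∀ T S : M, (∀ x, Commute x T → Commute x S) → δ S ≤ δ T →
      ∀ x, Commute x S → Commute x T)
    {T S : M} (g h : Mˣ) (hg : ∀ x, Commute x T → Commute x (g * S * ↑g⁻¹))
    (hh : ∀ x, Commute x S → Commute x (h * T * ↑h⁻¹)) :
    (orbitEquivalence (ConjAct Mˣ) M).r T S := by
  -- The chain `δ (g S g⁻¹) ≤ δ S ≤ δ (h T h⁻¹) ≤ δ T` closes the loop.
  have hδ : δ (g * S * ↑g⁻¹) ≤ δ T :=
    (hconj g S).trans ((hmono _ _ hh).trans (hconj h T))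
  have hiff : ∀ x, Commute x T ↔ Commute x (g * S * ↑g⁻¹) :=
    fun x => ⟨hg x, heq _ _ hg hδ x⟩
  have hmem : ∀ (k : ConjAct Mˣ) (R : M), k ∈ MulAction.stabilizer (ConjAct Mˣ) R ↔
      Commute ((ConjAct.ofConjAct k : Mˣ) : M) R := by
    intro k R
    rw [MulAction.mem_stabilizer_iff, ConjAct.units_smul_def, Units.mul_inv_eq_iff_eq_mul]
    rfl
  have hstab : MulAction.stabilizer (ConjAct Mˣ) T =
      MulAction.stabilizer (ConjAct Mˣ) (ConjAct.toConjAct g • S) := by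
    ext k
    rw [hmem, hmem]
    exact hiff _
  refine ⟨(ConjAct.toConjAct g)⁻¹, ?_⟩
  rw [hstab, MulAction.stabilizer_smul_eq_stabilizer_map_conj, map_inv, inv_smul_eq_iff]
  rfl

/-- Here `δ` is the dimension of the full centralizer algebra, a linear subspace, unlike the group
of its units. -/
lemma orbitEquivalence_end {F : Type*} [Field F] {V : Type*} [AddCommGroup V] [Module F V]
    [FiniteDimensional F V] {T S : V →ₗ[F] V} (g h : (V →ₗ[F] V)ˣ)
    (hg : ∀ x, Commute x T → Commute x (g * S * ↑g⁻¹))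
    (hh : ∀ x, Commute x S → Commute x (h * T * ↑h⁻¹)) :
    (orbitEquivalence (ConjAct (V →ₗ[F] V)ˣ) (V →ₗ[F] V)).r T S := by
  let Z : (V →ₗ[F] V) → Submodule F (V →ₗ[F] V) := fun T =>
    Subalgebra.toSubmodule (Subalgebra.centralizer F {T})
  have hZ : ∀ T x, x ∈ Z T ↔ Commute x T := by
    intro T x
    simp only [Z, Subalgebra.mem_toSubmodule, Subalgebra.mem_centralizer_iff,
      Set.mem_singleton_iff, forall_eq]
    exact eq_comm
  have hle : ∀ T S, (∀ x, Commute x T → Commute x S) → Z T ≤ Z S :=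
    fun T S h x hx => (hZ S x).2 (h x ((hZ T x).1 hx))
  refine orbitEquivalence_of_commute (fun T => Module.finrank F (Z T)) ?_ ?_ ?_ g h hg hh
  · intro g T
    let c : (V →ₗ[F] V) →ₗ[F] (V →ₗ[F] V) :=
      LinearMap.mulLeft F (↑g⁻¹ : V →ₗ[F] V) ∘ₗ LinearMap.mulRight F (↑g : V →ₗ[F] V)
    have hc : ∀ x, c x = ↑g⁻¹ * (x * ↑g) := fun x => rfl
    have hcZ : ∀ x ∈ Z (g * T * ↑g⁻¹), c x ∈ Z T := by
      intro x hx
      rw [hZ] at hx ⊢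
      rw [hc]
      have h1 : x * (g * T * ↑g⁻¹) = g * T * ↑g⁻¹ * x := hx
      change ↑g⁻¹ * (x * ↑g) * T = T * (↑g⁻¹ * (x * ↑g))
      have h2 : ↑g⁻¹ * (x * (g * T * ↑g⁻¹)) * ↑g = ↑g⁻¹ * (g * T * ↑g⁻¹ * x) * ↑g := by rw [h1]
      simpa [mul_assoc] using h2
    refine LinearMap.finrank_le_finrank_of_injective (f := c.restrict hcZ) ?_
    intro x y hxy
    have h1 : c x = c y := congrArg Subtype.val hxy
    rw [hc, hc] at h1
    exact Subtype.ext (by simpa using h1)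
  · intro T S h
    exact Submodule.finrank_mono (hle T S h)
  · intro T S h hd x hx
    have := Submodule.eq_of_le_of_finrank_le (hle T S h) hd
    rw [← hZ, this, hZ]
    exact hx

/-- The displacements `x - 1` of the affine maps `x` commuting with `T`. -/
def affineCentralizerDirection {F : Type*} [Field F] {V : Type*} [AddCommGroup V] [Module F V]
    (T : V →ᵃ[F] V) : Submodule F (V →ᵃ[F] V) where
  carrier := {D | ∀ v, D (T v) = T.linear (D v)}
  add_mem' := by
    intro a b ha hb v
    simp [ha v, hb v]
  zero_mem' := by intro v; simp
  smul_mem' := by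
    intro c a ha v
    simp [ha v]

/-- The affine maps commuting with `T` need not form a linear subspace, but subtracting the identity
turns them into one, so that dimensions can be compared. -/
lemma commute_iff_sub_mem_affineCentralizerDirection {F : Type*} [Field F] {V : Type*}
    [AddCommGroup V] [Module F V] (T x : V →ᵃ[F] V) :
    Commute x T ↔ x - AffineMap.id F V ∈ affineCentralizerDirection T := by
  have h : ∀ v, T.linear (x v - v) = T (x v) - T v := fun v => T.linearMap_vsub (x v) v
  change x * T = T * x ↔ ∀ v, _
  rw [AffineMap.ext_iff]
  refine forall_congr' fun v => ?_
  simp only [AffineMap.coe_mul, Function.comp_apply, AffineMap.coe_sub, Pi.sub_apply,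
    AffineMap.id_apply]
  rw [h, sub_left_inj]

lemma orbitEquivalence_affineMap {F : Type*} [Field F] {V : Type*} [AddCommGroup V] [Module F V]
    [FiniteDimensional F V] {T S : V →ᵃ[F] V} (g h : (V →ᵃ[F] V)ˣ)
    (hg : ∀ x, Commute x T → Commute x (g * S * ↑g⁻¹))
    (hh : ∀ x, Commute x S → Commute x (h * T * ↑h⁻¹)) :
    (orbitEquivalence (ConjAct (V →ᵃ[F] V)ˣ) (V →ᵃ[F] V)).r T S := by
  have : FiniteDimensional F (V →ᵃ[F] V) :=
    (AffineMap.toConstProdLinearMap (k := F) (V1 := V) (V2 := V) F).symm.finiteDimensional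
  have hZ := commute_iff_sub_mem_affineCentralizerDirection (F := F) (V := V)
  have hle : ∀ T S : V →ᵃ[F] V, (∀ x, Commute x T → Commute x S) →
      affineCentralizerDirection T ≤ affineCentralizerDirection S := by
    intro T S h x hx
    have h1 := h (x + AffineMap.id F V)
    rw [hZ, hZ, add_sub_cancel_right] at h1
    exact h1 hx
  refine orbitEquivalence_of_commute
    (fun T => Module.finrank F (affineCentralizerDirection T)) ?_ ?_ ?_ g h hg hh
  · intro g T
    have hgg : ∀ v, (g : V →ᵃ[F] V) ((↑g⁻¹ : V →ᵃ[F] V) v) = v := fun v =>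
      congrArg (fun f : V →ᵃ[F] V => f v) g.mul_inv
    have hgg' : ∀ v, (↑g⁻¹ : V →ᵃ[F] V) ((g : V →ᵃ[F] V) v) = v := fun v =>
      congrArg (fun f : V →ᵃ[F] V => f v) g.inv_mul
    have hlin : ∀ v, (↑g⁻¹ : V →ᵃ[F] V).linear ((g : V →ᵃ[F] V).linear v) = v := by
      intro v
      have := congrArg (fun f : V →ᵃ[F] V => f.linear v) g.inv_mul
      exact this
    have hlin' : ∀ v, (g : V →ᵃ[F] V).linear ((↑g⁻¹ : V →ᵃ[F] V).linear v) = v := by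
      intro v
      have := congrArg (fun f : V →ᵃ[F] V => f.linear v) g.mul_inv
      exact this
    -- Displacements are vectors, so conjugation acts on their values through the linear part only.
    let c : (V →ᵃ[F] V) →ₗ[F] (V →ᵃ[F] V) :=
      { toFun := fun D => (↑g⁻¹ : V →ᵃ[F] V).linear.toAffineMap.comp (D.comp (g : V →ᵃ[F] V))
        map_add' := fun a b => by ext v; simp
        map_smul' := fun a b => by ext v; simp }
    have hc : ∀ D v, c D v = (↑g⁻¹ : V →ᵃ[F] V).linear (D ((g : V →ᵃ[F] V) v)) := fun D v => rfl
    have hcZ : ∀ x ∈ affineCentralizerDirection ((g : V →ᵃ[F] V) * T * (↑g⁻¹ : V →ᵃ[F] V)),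
        c x ∈ affineCentralizerDirection T := by
      intro x hx v
      have h1 : x ((g : V →ᵃ[F] V) (T ((↑g⁻¹ : V →ᵃ[F] V) ((g : V →ᵃ[F] V) v)))) = (g : V →ᵃ[F] V).linear
        (T.linear ((↑g⁻¹ : V →ᵃ[F] V).linear (x ((g : V →ᵃ[F] V) v)))) := hx ((g : V →ᵃ[F] V) v)
      rw [hgg'] at h1
      rw [hc, hc, h1, hlin]
    refine LinearMap.finrank_le_finrank_of_injective (f := c.restrict hcZ) ?_
    intro x y hxy
    have h1 : c x = c y := congrArg Subtype.val hxy
    apply Subtype.ext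
    ext v
    have h2 := congrArg (fun f : V →ᵃ[F] V => (g : V →ᵃ[F] V).linear (f ((↑g⁻¹ : V →ᵃ[F] V) v))) h1
    simpa only [hc, hlin', hgg] using h2
  · intro T S h
    exact Submodule.finrank_mono (hle T S h)
  · intro T S h hd x hx
    have := Submodule.eq_of_le_of_finrank_le (hle T S h) hd
    rw [hZ, this, ← hZ]
    exact hx

end ZClasses

/-! ### Affine maps of `V` as linear maps of `V × F`. -/

section Homogenization

variable {F : Type*} [Field F] {V : Type*} [AddCommGroup V] [Module F V]

/-- The linear map of `V × F` that restricts to the affine map `T` on `V × {1}`. -/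
def homogenization (T : V →ᵃ[F] V) : Module.End F (V × F) :=
  (T.linear.coprod (LinearMap.toSpanSingleton F V (T 0))).prod (LinearMap.snd F V F)

lemma homogenization_apply (T : V →ᵃ[F] V) (w : V × F) :
    homogenization T w = (T.linear w.1 + w.2 • T 0, w.2) := rfl

lemma homogenization_apply_one (T : V →ᵃ[F] V) (v : V) : homogenization T (v, 1) = (T v, 1) := by
  rw [homogenization_apply, one_smul]
  congr 1
  exact (congrFun T.decomp v).symm

/-- The slice `V × {1}` spans `V × F`. -/
lemma linearMap_ext_of_apply_one {W : Type*} [AddCommGroup W] [Module F W]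
    {A B : V × F →ₗ[F] W} (h : ∀ v : V, A (v, 1) = B (v, 1)) : A = B := by
  have h0 := h 0
  ext v
  · have h1 : ((v, 0) : V × F) = (v, 1) - (0, 1) := by simp
    simp only [LinearMap.coe_comp, LinearMap.coe_inl, Function.comp_apply]
    rw [h1, map_sub, map_sub, h, h0]
  · simpa using h0

lemma homogenization_mul (S T : V →ᵃ[F] V) : homogenization (S * T) = homogenization S * homogenization T := by
  refine linearMap_ext_of_apply_one fun v => ?_
  rw [Module.End.mul_apply, homogenization_apply_one, homogenization_apply_one, homogenization_apply_one]
  rfl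

/-- The affine map of `V` induced on `V × {1}` by a linear map of `V × F`. -/
def dehomogenization (A : V × F →ₗ[F] V × F) : V →ᵃ[F] V where
  toFun v := (A (v, 1)).1
  linear := LinearMap.fst F V F ∘ₗ A ∘ₗ LinearMap.inl F V F
  map_vadd' v w := by
    have : ((w + v, 1) : V × F) = (w, 0) + (v, 1) := by simp
    simp only [vadd_eq_add, this, map_add]
    rfl

lemma dehomogenization_apply {A : V × F →ₗ[F] V × F} (hA : ∀ w, (A w).2 = w.2) (v : V) :
    ((dehomogenization A v, 1) : V × F) = A (v, 1) :=
  Prod.ext rfl (hA (v, 1)).symm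

/-- An intertwiner of homogenizations preserving the last coordinate gives an affine unit. -/
lemma exists_unit_of_intertwining {T S : V →ᵃ[F] V} {f : F[X]} (g : (V × F) ≃ₗ[F] (V × F))
    (hg : ∀ w, (g w).2 = w.2)
    (hgf : ∀ w, g (homogenization S w) = aeval (homogenization T) f (g w)) :
    ∃ γ : (V →ᵃ[F] V)ˣ, ∀ x, Commute x T → Commute x (γ * S * ↑γ⁻¹) := by
  have hg' : ∀ w, (g.symm w).2 = w.2 := fun w => by rw [← hg, g.apply_symm_apply]
  have h1 : ∀ v, ((dehomogenization g.toLinearMap v, 1) : V × F) = g (v, 1) :=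
    dehomogenization_apply (A := g.toLinearMap) hg
  have h2 : ∀ v, ((dehomogenization g.symm.toLinearMap v, 1) : V × F) = g.symm (v, 1) :=
    dehomogenization_apply (A := g.symm.toLinearMap) hg'
  let γ : (V →ᵃ[F] V)ˣ :=
    { val := dehomogenization g.toLinearMap
      inv := dehomogenization g.symm.toLinearMap
      val_inv := by
        ext v
        have : ((dehomogenization g.toLinearMap (dehomogenization g.symm.toLinearMap v), 1) : V × F)
            = (v, 1) := by rw [h1, h2, g.apply_symm_apply]
        exact congrArg Prod.fst this
      inv_val := by
        ext v
        have : ((dehomogenization g.symm.toLinearMap (dehomogenization g.toLinearMap v), 1) : V × F)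
            = (v, 1) := by rw [h2, h1, g.symm_apply_apply]
        exact congrArg Prod.fst this }
  refine ⟨γ, fun x hx => ?_⟩
  have hR : ∀ v, (((γ * S * ↑γ⁻¹ : V →ᵃ[F] V) v, 1) : V × F) =
      aeval (homogenization T) f (v, 1) := by
    intro v
    change ((dehomogenization g.toLinearMap (S (dehomogenization g.symm.toLinearMap v)), 1) : V × F) = _
    rw [h1, ← homogenization_apply_one, hgf, h2, g.apply_symm_apply]
  have hcomm : Commute (homogenization x) (aeval (homogenization T) f) := by
    have h3 : Commute (homogenization x) (homogenization T) := by
      change _ * _ = _ * _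
      rw [← homogenization_mul, ← homogenization_mul, hx.eq]
    have h4 : aeval (homogenization T) f ∈ Subalgebra.centralizer F {homogenization x} := by
      refine Algebra.adjoin_le ?_ (aeval_mem_adjoin_singleton F (homogenization T))
      rw [Set.singleton_subset_iff]
      intro y hy
      rw [Set.mem_singleton_iff.1 hy]
      exact h3
    exact h4 _ rfl
  change _ * _ = _ * _
  ext v
  have h5 : ((x ((γ * S * ↑γ⁻¹ : V →ᵃ[F] V) v), 1) : V × F) =
      ((γ * S * ↑γ⁻¹ : V →ᵃ[F] V) (x v), 1) := by
    rw [← homogenization_apply_one, hR, hR, ← homogenization_apply_one, ← Module.End.mul_apply, hcomm.eq,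
      Module.End.mul_apply]
  exact congrArg Prod.fst h5

end Homogenization

/-! ### Finitely many types, and the two finiteness theorems. -/

section Finiteness

lemma exists_finite_residueField_invariant {F : Type u} [Field F] {n : ℕ}
    (hF : HasFinitelyManyExtensionsOfDegreeLE F n) :
    ∃ (Q : Type (u + 1)) (_ : Finite Q) (c : F[X] → Q), ∀ p q : F[X], Irreducible p →
      Irreducible q → p.natDegree ≤ n → q.natDegree ≤ n → c p = c q →
      Nonempty (AdjoinRoot q ≃ₐ[F] AdjoinRoot p) := by
  classical
  let ext : ∀ p : F[X], Irreducible p → p.natDegree ≤ n → BoundedDegreeExtension F n :=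
    fun p hp hd =>
      letI : Fact (Irreducible p) := ⟨hp⟩
      letI : FiniteDimensional F (AdjoinRoot p) := (AdjoinRoot.powerBasis hp.ne_zero).finite
      { carrier := AdjoinRoot p
        degree_le := by
          rwa [(AdjoinRoot.powerBasis hp.ne_zero).finrank, AdjoinRoot.powerBasis_dim] }
  have : Finite (Quotient (BoundedDegreeExtension.isoSetoid F n)) := hF
  -- The value `none` is a default for polynomials that are reducible or of too large degree.
  refine ⟨Option (Quotient (BoundedDegreeExtension.isoSetoid F n)), inferInstance,
    fun p => if h : Irreducible p ∧ p.natDegree ≤ n then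
      some (Quotient.mk _ (ext p h.1 h.2)) else none, ?_⟩
  intro p q hp hq hpn hqn h
  beta_reduce at h
  rw [dif_pos ⟨hp, hpn⟩, dif_pos ⟨hq, hqn⟩, Option.some_inj] at h
  obtain ⟨φ⟩ := Quotient.exact h
  exact ⟨AlgEquiv.symm φ⟩

/-- The discrete invariants of a decomposition into at most `N` cyclic modules: their number,
their exponents, the classes of their residue fields and the coincidences between the primes. -/
abbrev DecompositionType (N : ℕ) (Q : Type*) :=
  Σ d : Fin (N + 1), (Fin d → Fin (N + 1)) × (Fin d → Q) × (Fin d → Fin d → Prop)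

/-- The primes `p` realise the decomposition type `k`. -/
structure DecompositionType.Realizes {F : Type*} [Field F] {N : ℕ} {Q : Type*} (n : ℕ)
    (c : F[X] → Q) (k : DecompositionType N Q) (p : Fin k.1 → F[X]) : Prop where
  irreducible : ∀ i, Irreducible (p i)
  monic : ∀ i, (p i).Monic
  natDegree_le : ∀ i, (p i).natDegree ≤ n
  invariant : ∀ i, c (p i) = k.2.2.1 i
  eq_iff : ∀ i j, k.2.2.2 i j ↔ p i = p j

/-- The exponents of a decomposition type. -/
abbrev DecompositionType.exponent {N : ℕ} {Q : Type*} (k : DecompositionType N Q) :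
    Fin k.1 → ℕ := fun i => k.2.1 i

variable {F : Type u} [Field F]

lemma CyclicDecomposition.exists_intertwining_of_realizes {W : Type*} [AddCommGroup W]
    [Module F W] {T S : Module.End F W} {n N : ℕ} {Q : Type*} {c : F[X] → Q}
    (hc : ∀ p q : F[X], Irreducible p →
      Irreducible q → p.natDegree ≤ n → q.natDegree ≤ n → c p = c q →
      Nonempty (AdjoinRoot q ≃ₐ[F] AdjoinRoot p))
    {k : DecompositionType N Q} {p q : Fin k.1 → F[X]} (hp : k.Realizes n c p)
    (hq : k.Realizes n c q)
    (D : CyclicDecomposition T p k.exponent) (E : CyclicDecomposition S q k.exponent) :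
    ∃ (f : F[X]) (g : W ≃ₗ[F] W), (∀ w, g (S w) = aeval T f (g w)) ∧
      (∀ i, p i ∣ (q i).comp f) ∧
      ∀ w i h, E.toEquiv w i = AdjoinRoot.mk _ h →
        D.toEquiv (g w) i = AdjoinRoot.mk _ (h.comp f) :=
  D.exists_intertwining E hp.irreducible hp.monic hq.irreducible
    (fun i j h => (hq.eq_iff i j).1 ((hp.eq_iff i j).2 h))
    (fun i => hc _ _ (hp.irreducible i) (hq.irreducible i) (hp.natDegree_le i)
      (hq.natDegree_le i) ((hp.invariant i).trans (hq.invariant i).symm))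

/-- Each term of the sum is positive, which bounds both the number of factors and the exponents by
`N`. The degree bound `n` is kept separate because the affine case has `N = n + 1`. -/
lemma exists_realizes {N n d : ℕ} {Q : Type*} (c : F[X] → Q) {p : Fin d → F[X]} {e : Fin d → ℕ}
    (hp : ∀ i, Irreducible (p i)) (hpm : ∀ i, (p i).Monic) (he : ∀ i, 0 < e i)
    (hsum : ∑ i, e i * (p i).natDegree = N) (hdeg : ∀ i, (p i).natDegree ≤ n) :
    ∃ k : DecompositionType N Q, ∃ hk : (k.1 : ℕ) = d,
      k.Realizes n c (fun i => p (Fin.cast hk i)) ∧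
      k.exponent = fun i => e (Fin.cast hk i) := by
  have hpos : ∀ i, 0 < (p i).natDegree := fun i => (hp i).natDegree_pos
  have hd : d ≤ N := by
    rw [← hsum]
    calc d = ∑ _i : Fin d, 1 := by simp
      _ ≤ _ := Finset.sum_le_sum fun i _ => Nat.mul_pos (he i) (hpos i)
  have hle : ∀ i, e i ≤ N := fun i =>
    (Nat.le_mul_of_pos_right _ (hpos i)).trans (hsum ▸
      Finset.single_le_sum (f := fun i => e i * (p i).natDegree) (fun _ _ => Nat.zero_le _)
        (Finset.mem_univ i))
  refine ⟨⟨⟨d, Nat.lt_succ_of_le hd⟩, fun i => ⟨e i, Nat.lt_succ_of_le (hle i)⟩,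
    fun i => c (p i), fun i j => p i = p j⟩, rfl, ⟨?_, ?_, ?_, ?_, ?_⟩, rfl⟩
  · exact fun i => hp i
  · exact fun i => hpm i
  · exact fun i => hdeg i
  · exact fun i => rfl
  · exact fun i j => Iff.rfl

variable {V : Type v} [AddCommGroup V] [Module F V] [FiniteDimensional F V]

theorem finite_zClass_end (hF : HasFinitelyManyExtensionsOfDegreeLE F (Module.finrank F V)) :
    Finite (ZClass (V →ₗ[F] V)) := by
  obtain ⟨Q, _, c, hc⟩ := exists_finite_residueField_invariant hF
  refine finite_quotient_of_invariant (K := DecompositionType (Module.finrank F V) Q) _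
    (fun T k => ∃ p : Fin k.1 → F[X], k.Realizes (Module.finrank F V) c p ∧
      Nonempty (CyclicDecomposition T p k.exponent)) ?_ ?_
  · intro T
    obtain ⟨d, p, e, hp, hpm, he, ⟨D⟩⟩ := CyclicDecomposition.exists_fin T
    have hsum := D.sum_mul_natDegree hp
    have hdeg : ∀ i, (p i).natDegree ≤ Module.finrank F V := fun i =>
      (Nat.le_mul_of_pos_left _ (he i)).trans (hsum ▸
        Finset.single_le_sum (f := fun i => e i * (p i).natDegree) (fun _ _ => Nat.zero_le _)
          (Finset.mem_univ i))
    obtain ⟨k, rfl, hk, hke⟩ := exists_realizes c hp hpm he hsum hdeg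
    exact ⟨k, p, hk, hke ▸ ⟨D⟩⟩
  · have key : ∀ (T S : V →ₗ[F] V) (k : DecompositionType (Module.finrank F V) Q),
        (∃ p : Fin k.1 → F[X], k.Realizes (Module.finrank F V) c p ∧
          Nonempty (CyclicDecomposition T p k.exponent)) →
        (∃ p : Fin k.1 → F[X], k.Realizes (Module.finrank F V) c p ∧
          Nonempty (CyclicDecomposition S p k.exponent)) →
        ∃ g : (V →ₗ[F] V)ˣ, ∀ x, Commute x T → Commute x (g * S * ↑g⁻¹) := by
      rintro T S k ⟨p, hp, ⟨D⟩⟩ ⟨q, hq, ⟨E⟩⟩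
      obtain ⟨f, g, hg, -, -⟩ := D.exists_intertwining_of_realizes hc hp hq E
      refine ⟨LinearMap.GeneralLinearGroup.ofLinearEquiv g, fun x hx => ?_⟩
      have h1 : ((LinearMap.GeneralLinearGroup.ofLinearEquiv g : (V →ₗ[F] V)ˣ) : V →ₗ[F] V) * S *
          ↑(LinearMap.GeneralLinearGroup.ofLinearEquiv g)⁻¹ = aeval T f := by
        rw [Units.mul_inv_eq_iff_eq_mul]
        exact LinearMap.ext hg
      have h2 : aeval T f ∈ Subalgebra.centralizer F {x} := by
        refine Algebra.adjoin_le ?_ (aeval_mem_adjoin_singleton F T)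
        rw [Set.singleton_subset_iff]
        intro y hy
        rw [Set.mem_singleton_iff.1 hy]
        exact hx
      rw [h1]
      exact h2 _ rfl
    intro T S k hT hS
    obtain ⟨g, hg⟩ := key T S k hT hS
    obtain ⟨h, hh⟩ := key S T k hS hT
    exact orbitEquivalence_end g h hg hh

theorem finite_zClass_affineMap
    (hF : HasFinitelyManyExtensionsOfDegreeLE F (Module.finrank F V)) :
    Finite (ZClass (V →ᵃ[F] V)) := by
  -- In dimension `0` the prime `X - 1` would exceed the degree bound.
  rcases subsingleton_or_nontrivial V with hV | hV
  · have : Subsingleton (V →ᵃ[F] V) := ⟨fun a b => by ext v; exact Subsingleton.elim _ _⟩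
    infer_instance
  have hn : 1 ≤ Module.finrank F V := Module.finrank_pos
  obtain ⟨Q, _, c, hc⟩ := exists_finite_residueField_invariant hF
  -- The invariant also marks the factor carrying the last-coordinate functional.
  let R : (V →ᵃ[F] V) → (Σ k : DecompositionType (Module.finrank F V + 1) Q, Fin k.1) → Prop :=
    fun T k => ∃ (p : Fin k.1.1 → F[X])
      (E : CyclicDecomposition (homogenization T) p k.1.exponent),
      k.1.Realizes (Module.finrank F V) c p ∧ p k.2 = X - C 1 ∧
      ∀ w h, E.toEquiv w k.2 = AdjoinRoot.mk _ h → w.2 = h.eval 1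
  refine finite_quotient_of_invariant _ R ?_ ?_
  · intro T
    obtain ⟨d, p, e, hp, hpm, he, ⟨D⟩⟩ := CyclicDecomposition.exists_fin (homogenization T)
    obtain ⟨i₀, E, hi₀, hE⟩ := D.exists_eval_one hp hpm (φ := LinearMap.snd F V F)
      (fun h => one_ne_zero (LinearMap.congr_fun h ((0, 1) : V × F))) (fun w => rfl)
    have hsum := D.sum_mul_natDegree hp
    rw [Module.finrank_prod, Module.finrank_self] at hsum
    have hdeg₀ : (p i₀).natDegree = 1 := by rw [hi₀, natDegree_X_sub_C]
    -- Although `V × F` has dimension `n + 1`, factor `i₀` uses at least one dimension, so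
    -- extensions of degree at most `n` suffice.
    have hdeg : ∀ i, (p i).natDegree ≤ Module.finrank F V := by
      intro i
      by_cases hi : i = i₀
      · rw [hi, hdeg₀]; exact hn
      · have h1 : ∑ j ∈ {i, i₀}, e j * (p j).natDegree ≤ Module.finrank F V + 1 :=
          hsum ▸ Finset.sum_le_sum_of_subset (Finset.subset_univ _)
        rw [Finset.sum_pair hi, hdeg₀] at h1
        have h2 := Nat.le_mul_of_pos_left (p i).natDegree (he i)
        have h3 := he i₀
        omega
    obtain ⟨k, rfl, hk, hke⟩ := exists_realizes c hp hpm he hsum hdeg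
    have hke' : e = k.exponent := hke.symm
    subst hke'
    exact ⟨⟨k, i₀⟩, p, E, hk, hi₀, hE⟩
  · have key : ∀ T S k, R T k → R S k →
        ∃ g : (V →ᵃ[F] V)ˣ, ∀ x, Commute x T → Commute x (g * S * ↑g⁻¹) := by
      rintro T S ⟨k, i₀⟩ ⟨p, D, hp, hpi, hD⟩ ⟨q, E, hq, hqi, hE⟩
      obtain ⟨f, g, hg, hdvd, hmk⟩ := D.exists_intertwining_of_realizes hc hp hq E
      refine exists_unit_of_intertwining g (fun w => ?_) hg
      -- Both marked primes are `X - 1`, so `X - 1 ∣ f - 1`; hence `h(f)` and `h` agree at `1` and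
      -- the last coordinate is preserved.
      have hf : f.eval 1 = 1 := by
        have h1 := hdvd i₀
        simp only [] at hpi hqi
        rw [hpi, hqi, sub_comp, X_comp, C_comp, dvd_iff_isRoot, IsRoot.def, eval_sub, eval_C,
          sub_eq_zero] at h1
        exact h1
      obtain ⟨h, hh⟩ := AdjoinRoot.mk_surjective (E.toEquiv w i₀)
      rw [hE w h hh.symm, hD _ _ (hmk w i₀ h hh.symm), eval_comp, hf]
    intro T S k hT hS
    obtain ⟨g, hg⟩ := key T S k hT hS
    obtain ⟨h, hh⟩ := key S T k hS hT
    exact orbitEquivalence_affineMap g h hg hh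

end Finiteness

/-- `GL(V)` is the group of units of the monoid `V →ₗ[F] V` of linear maps, and `GA(V)` is the
group of units of the monoid `V →ᵃ[F] V` of affine maps, both under composition. -/
theorem theorem7p4 {F : Type u} [Field F] {V : Type v} [AddCommGroup V] [Module F V]
    [FiniteDimensional F V] (n : ℕ) (hn : Module.finrank F V = n)
    (hF : HasFinitelyManyExtensionsOfDegreeLE F n) :
    Finite (ZClass (V →ₗ[F] V)) ∧ Finite (ZClass (V →ᵃ[F] V)) := by
  subst hn
  exact ⟨finite_zClass_end hF, finite_zClass_affineMap hF⟩
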